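/- Let $H$ be a complex Hilbert space, let $T$ be a bounded linear operator on $H$, and write $\Delta_T = T^*T - I$. Then the following statements are equivalent: (i) $T$ is expansive (i.e. $T^*T \ge I$) and $T$ has a minimal $2$-isometric lifting of type I. That is, there are a Hilbert space $K$ containing $H$ as a closed subspace and a bounded operator $S$ on $K$ such that: $S$ is a lifting of $T$, i.e. $P_H S = T P_H$, where $P_H : K \to H$ is the orthogonal projection (equivalently, $S^*h = T^*h$ for all $h\in H$); $S$ is a $2$-isometry, i.e. $S^*\Delta_S S = \Delta_S$; $S$ is of type I, i.e. $K \ominus H \subset \ker \Delta_S$; and $S$ is minimal, i.e. $K = \bigvee_{n \ge 0} S^n H$. (ii) There is a bounded operator $A \ge 0$ on $H$ such that $T^*AT \le A$ (i.e. $T$ is an $A$-contraction) and $A \ge \Delta_T \ge 0$. (iii) There are a Hilbert space $K = K_0 \oplus K_1$ (orthogonal sum), an isometry $Z : H \to K$, and a real number $\delta \ge \|\Delta_T\|^{1/2}$ such that $ZT = \widetilde T Z$ (i.e. $\widetilde T$ is an extension of $T$), where $$\widetilde T = \begin{pmatrix} V & \delta E \\ 0 & U \end{pmatrix} \quad \text{on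 } K_0 \oplus K_1,$$ $V$ is an isometry on $K_0$, $U$ is a unitary operator on $K_1$, and $E : K_1 \to K_0$ is a contraction (i.e. $\|E\| \le 1$) with $V^*E = 0$. Moreover, for every operator $A$ as in (ii), the extension $\widetilde T$ in (iii) can be chosen with $\delta = \|A\|^{1/2}$. -/

import Mathlib

open scoped InnerProductSpace

universe u v

namespace TwoIsometricLifting

section

variable {H : Type u} [NormedAddCommGroup H] [InnerProductSpace ℂ H] [CompleteSpace H]
variable {K : Type v} [NormedAddCommGroup K] [InnerProductSpace ℂ K] [CompleteSpace K]

/-- The operator `Δ_T = T* T - I`. -/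
noncomputable def Delta (T : H →L[ℂ] H) : H →L[ℂ] H :=
  ContinuousLinearMap.adjoint T ∘L T - ContinuousLinearMap.id ℂ H

/-- `T` is expansive: `T* T ≥ I`, for the usual (Loewner) order of operators. -/
def IsExpansive (T : H →L[ℂ] H) : Prop :=
  ContinuousLinearMap.id ℂ H ≤ ContinuousLinearMap.adjoint T ∘L T

/-- `S` is a 2-isometry: `S* Δ_S S = Δ_S`. -/
def IsTwoIsometry (S : H →L[ℂ] H) : Prop :=
  ContinuousLinearMap.adjoint S ∘L Delta S ∘L S = Delta S

/-- `T` is an `A`-contraction: `A ≥ 0` and `T* A T ≤ A`. -/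
def IsAContraction (T A : H →L[ℂ] H) : Prop :=
  0 ≤ A ∧ ContinuousLinearMap.adjoint T ∘L A ∘L T ≤ A

/-- `T'` on `K` is an extension of `T` on `H`, where `H` is regarded as a closed subspace of `K`
through the isometric embedding `Z`: `Z T = T' Z`. -/
def IsExtension (Z : H →ₗᵢ[ℂ] K) (T : H →L[ℂ] H) (T' : K →L[ℂ] K) : Prop :=
  Z.toContinuousLinearMap ∘L T = T' ∘L Z.toContinuousLinearMap

/-- `S` on `K` is a lifting of `T` on `H` (through the embedding `Z` of `H` into `K`):
`S*` is an extension of `T*`. -/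
def IsLifting (Z : H →ₗᵢ[ℂ] K) (T : H →L[ℂ] H) (S : K →L[ℂ] K) : Prop :=
  IsExtension Z (ContinuousLinearMap.adjoint T) (ContinuousLinearMap.adjoint S)

/-- Minimality of a lifting `S` on `K`: the closed linear span of the subspaces `Sⁿ H`, `n ≥ 0`,
is the whole of `K`. -/
def IsMinimal (Z : H →ₗᵢ[ℂ] K) (S : K →L[ℂ] K) : Prop :=
  (⨆ n : ℕ, (LinearMap.range Z.toLinearMap).map (S ^ n).toLinearMap).topologicalClosure = ⊤

/-- The type I condition on a lifting `S` on `K ⊇ H`: the orthogonal complement of `H` in `K` is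
contained in the kernel of `Δ_S`. -/
def IsTypeI (Z : H →ₗᵢ[ℂ] K) (S : K →L[ℂ] K) : Prop :=
  (LinearMap.range Z.toLinearMap)ᗮ ≤ LinearMap.ker (Delta S).toLinearMap

/-- `T` has a minimal 2-isometric lifting of type I, on some Hilbert space containing `H`. -/
def HasMinimalTypeILifting (T : H →L[ℂ] H) : Prop :=
  ∃ (K : Type u) (_ : NormedAddCommGroup K) (_ : InnerProductSpace ℂ K) (_ : CompleteSpace K)
    (Z : H →ₗᵢ[ℂ] K) (S : K →L[ℂ] K),
    IsLifting Z T S ∧ IsTwoIsometry S ∧ IsTypeI Z S ∧ IsMinimal Z S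

end

section

variable {K₀ : Type u} [NormedAddCommGroup K₀] [InnerProductSpace ℂ K₀]
variable {K₁ : Type v} [NormedAddCommGroup K₁] [InnerProductSpace ℂ K₁]

/-- The operator with block matrix `[[V, X], [0, U]]` on the Hilbert space direct sum
`K₀ ⊕ K₁`, i.e. `(x, y) ↦ (V x + X y, U y)`. -/
noncomputable def blockUpper (V : K₀ →L[ℂ] K₀) (X : K₁ →L[ℂ] K₀) (U : K₁ →L[ℂ] K₁) :
    WithLp 2 (K₀ × K₁) →L[ℂ] WithLp 2 (K₀ × K₁) :=
  (WithLp.prodContinuousLinearEquiv 2 ℂ K₀ K₁).symm.toContinuousLinearMap ∘L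
    ((V ∘L ContinuousLinearMap.fst ℂ K₀ K₁ + X ∘L ContinuousLinearMap.snd ℂ K₀ K₁).prod
      (U ∘L ContinuousLinearMap.snd ℂ K₀ K₁)) ∘L
    (WithLp.prodContinuousLinearEquiv 2 ℂ K₀ K₁).toContinuousLinearMap

theorem blockUpper_apply (V : K₀ →L[ℂ] K₀) (X : K₁ →L[ℂ] K₀) (U : K₁ →L[ℂ] K₁)
    (z : WithLp 2 (K₀ × K₁)) :
    blockUpper V X U z = WithLp.toLp 2 (V z.fst + X z.snd, U z.snd) := rfl

end

/-- `T` has an extension of the form `[[V, δ E], [0, U]]` on a Hilbert space `K₀ ⊕ K₁`, where `V`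
is an isometry, `U` is unitary, `E` is a contraction, `V* E = 0` and `δ ≥ ‖Δ_T‖^{1/2}`. -/
def HasBlockExtension {H : Type u} [NormedAddCommGroup H] [InnerProductSpace ℂ H] [CompleteSpace H]
    (T : H →L[ℂ] H) (δ : ℝ) : Prop :=
  ∃ (K₀ : Type u) (_ : NormedAddCommGroup K₀) (_ : InnerProductSpace ℂ K₀) (_ : CompleteSpace K₀)
    (K₁ : Type u) (_ : NormedAddCommGroup K₁) (_ : InnerProductSpace ℂ K₁) (_ : CompleteSpace K₁)
    (V : K₀ →L[ℂ] K₀) (E : K₁ →L[ℂ] K₀) (U : K₁ →L[ℂ] K₁)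
    (Z : H →ₗᵢ[ℂ] WithLp 2 (K₀ × K₁)),
    Isometry V ∧ U ∈ unitary (K₁ →L[ℂ] K₁) ∧ ‖E‖ ≤ 1 ∧
      ContinuousLinearMap.adjoint V ∘L E = 0 ∧ Real.sqrt ‖Delta T‖ ≤ δ ∧
      IsExtension Z T (blockUpper V ((δ : ℂ) • E) U)

end TwoIsometricLifting

/-!
Write `Δ_T = T* T - I`. Everything reduces to producing an *invariant majorant* of `Δ_T`: an
operator `B ≥ Δ_T` with `T* B T = B`.

* From a type I lifting `S`, the compression of `Δ_S` to `H` is an invariant majorant, because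
  `S h - T h` is orthogonal to `H` and hence killed by `Δ_S`. From a block extension with embedding
  `h ↦ (Z₀ h, Z₁ h)`, it is `δ² Z₁* Z₁`, because `Z₁ T = U Z₁` with `U` unitary.

* From an arbitrary `A ≥ Δ_T` with `T* A T ≤ A`, an invariant majorant of norm at most `a = ‖A‖` is
  the strong limit of an increasing sequence `A = B₀ ≤ B₁ ≤ … ≤ a` with `T* Bₙ₊₁ T = Bₙ`
  (`exists_invariant_majorant`). Prescribing `T* Bₙ₊₁ T` together with `Bₙ ≤ Bₙ₊₁ ≤ a` is an
  interpolation problem for `a - Bₙ₊₁`, which Douglas' lemma solves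
  (`exists_between_compression_eq`); its hypothesis is `T* Bₙ T ≤ Bₙ ≤ a ≤ a T* T`, and the last
  inequality is where expansivity enters.

* An invariant majorant `B` gives the lifting `S (h, s) = (T h, (D h, s 0, s 1, …))` with
  `D* D = B - Δ_T`, for which `Δ_S = B ⊕ 0` (`hasMinimalTypeILifting_of_invariant`).

* If moreover `‖B‖ ≤ δ²`, write `B = R* R` and `R = δ Z₁`. Then `‖Z₁ T h‖ = ‖Z₁ h‖`, so that
  `Z₁ h ↦ Z₁ T h` extends to a unitary `U` (`exists_unitary_of_norm_eq`). With
  `Z₀* Z₀ = I - Z₁* Z₁` and `Δ_T = d* d`, one has `‖Z₀ T h‖² = ‖Z₀ h‖² + ‖d h‖²`, so that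
  `(Z₀ h, d h) ↦ Z₀ T h` extends to an isometric row `(V, F)` (`exists_row_isometry`): its entries
  have orthogonal ranges. Finally `‖d h‖ ≤ ‖R h‖` factors `d` as `E₀ R`, and `E = F E₀`
  (`hasBlockExtension_of_invariant`).
-/

namespace TwoIsometricLifting

/-! ### Positive operators, Douglas' lemma and interpolation -/

section Positivity

variable {H : Type*} [NormedAddCommGroup H] [InnerProductSpace ℂ H]
variable {G : Type*} [NormedAddCommGroup G] [InnerProductSpace ℂ G] [CompleteSpace G]
variable {G' : Type*} [NormedAddCommGroup G'] [InnerProductSpace ℂ G'] [CompleteSpace G']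

theorem re_inner_le_of_le {A B : H →L[ℂ] H} (h : A ≤ B) (x : H) :
    (⟪A x, x⟫_ℂ).re ≤ (⟪B x, x⟫_ℂ).re := by
  have := (ContinuousLinearMap.le_def A B |>.mp h).re_inner_nonneg_left x
  simpa [inner_sub_left] using this

/-- Douglas' factorization lemma: an operator dominated by `R` factors through `R` by a
contraction. -/
theorem exists_contraction_comp_eq (R : H →L[ℂ] G) (X : H →L[ℂ] G')
    (h : ∀ x, ‖X x‖ ≤ ‖R x‖) :
    ∃ C : G →L[ℂ] G', ‖C‖ ≤ 1 ∧ ∀ x, C (R x) = X x := by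
  let M : Submodule ℂ G := (LinearMap.range R.toLinearMap).topologicalClosure
  have hM : ∀ x, R x ∈ M := fun x => subset_closure ⟨x, rfl⟩
  have : CompleteSpace M :=
    (LinearMap.range R.toLinearMap).isClosed_topologicalClosure.completeSpace_coe
  let e : H →ₗ[ℂ] M := R.toLinearMap.codRestrict M hM
  have hd : DenseRange e := by
    intro ⟨y, hy⟩
    rw [closure_subtype]
    have : ((↑) '' Set.range e : Set G) = Set.range R := by
      rw [← Set.range_comp]; rfl
    rw [this]
    exact hy
  have hb : ∀ x, ‖X.toLinearMap x‖ ≤ 1 * ‖e x‖ := fun x => by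
    rw [one_mul]; exact h x
  refine ⟨X.toLinearMap.extendOfNorm e ∘L M.orthogonalProjectionOnto, ?_, fun x => ?_⟩
  · refine (ContinuousLinearMap.opNorm_comp_le _ _).trans ?_
    exact mul_le_one₀ (LinearMap.opNorm_extendOfNorm_le hd zero_le_one hb) (norm_nonneg _)
      M.orthogonalProjectionOnto_norm_le
  · have : M.orthogonalProjectionOnto (R x) = e x :=
      M.orthogonalProjectionOnto_mem_subspace_eq_self (e x)
    rw [ContinuousLinearMap.comp_apply, this, LinearMap.extendOfNorm_eq hd ⟨1, hb⟩]
    rfl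

variable [CompleteSpace H]

theorem le_iff_re_inner_le {A B : H →L[ℂ] H} (hA : IsSelfAdjoint A) (hB : IsSelfAdjoint B) :
    A ≤ B ↔ ∀ x, (⟪A x, x⟫_ℂ).re ≤ (⟪B x, x⟫_ℂ).re := by
  rw [ContinuousLinearMap.le_def, ContinuousLinearMap.isPositive_def']
  simp only [hB.sub hA, true_and, ContinuousLinearMap.reApplyInnerSelf_apply,
    sub_apply, inner_sub_left, map_sub, sub_nonneg, RCLike.re_to_complex]

theorem re_inner_adjoint_comp_self (X : H →L[ℂ] G) (x : H) :
    (⟪(ContinuousLinearMap.adjoint X ∘L X) x, x⟫_ℂ).re = ‖X x‖ ^ 2 := by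
  simp only [ContinuousLinearMap.comp_apply, ContinuousLinearMap.adjoint_inner_left]
  exact (norm_sq_eq_re_inner (𝕜 := ℂ) (X x)).symm

theorem isSelfAdjoint_adjoint_comp_self (X : H →L[ℂ] G) :
    IsSelfAdjoint (ContinuousLinearMap.adjoint X ∘L X) :=
  (ContinuousLinearMap.isPositive_adjoint_comp_self X).isSelfAdjoint

theorem isSelfAdjoint_Delta (T : H →L[ℂ] H) : IsSelfAdjoint (Delta T) :=
  (isSelfAdjoint_adjoint_comp_self T).sub (IsSelfAdjoint.one _)

theorem re_inner_Delta (T : H →L[ℂ] H) (x : H) :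
    (⟪Delta T x, x⟫_ℂ).re = ‖T x‖ ^ 2 - ‖x‖ ^ 2 := by
  rw [Delta, sub_apply, inner_sub_left, Complex.sub_re,
    re_inner_adjoint_comp_self]
  congr 1
  exact (norm_sq_eq_re_inner (𝕜 := ℂ) x).symm

theorem eq_of_re_inner_eq {A B : H →L[ℂ] H} (hA : IsSelfAdjoint A) (hB : IsSelfAdjoint B)
    (h : ∀ x, (⟪A x, x⟫_ℂ).re = (⟪B x, x⟫_ℂ).re) : A = B :=
  le_antisymm ((le_iff_re_inner_le hA hB).2 fun x => (h x).le)
    ((le_iff_re_inner_le hB hA).2 fun x => (h x).ge)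

theorem adjoint_comp_self_le_iff {X : H →L[ℂ] G} {Y : H →L[ℂ] G'} :
    ContinuousLinearMap.adjoint X ∘L X ≤ ContinuousLinearMap.adjoint Y ∘L Y ↔
      ∀ x, ‖X x‖ ≤ ‖Y x‖ := by
  rw [le_iff_re_inner_le (isSelfAdjoint_adjoint_comp_self X) (isSelfAdjoint_adjoint_comp_self Y)]
  refine forall_congr' fun x => ?_
  rw [re_inner_adjoint_comp_self, re_inner_adjoint_comp_self,
    sq_le_sq₀ (norm_nonneg _) (norm_nonneg _)]

theorem exists_adjoint_comp_self_eq {A : H →L[ℂ] H} (hA : 0 ≤ A) :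
    ∃ R : H →L[ℂ] H, A = ContinuousLinearMap.adjoint R ∘L R :=
  CStarAlgebra.nonneg_iff_eq_star_mul_self.1 hA

/-- The defect operator of a contraction `C`: an operator `D` with `D* D = I - C* C`. -/
theorem exists_defect {C : H →L[ℂ] G} (hC : ∀ x, ‖C x‖ ≤ ‖x‖) :
    ∃ D : H →L[ℂ] H, ∀ x, ‖C x‖ ^ 2 + ‖D x‖ ^ 2 = ‖x‖ ^ 2 := by
  have h : ContinuousLinearMap.adjoint C ∘L C ≤
      ContinuousLinearMap.adjoint (ContinuousLinearMap.id ℂ H) ∘L ContinuousLinearMap.id ℂ H :=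
    adjoint_comp_self_le_iff.2 hC
  obtain ⟨D, hD⟩ := exists_adjoint_comp_self_eq (sub_nonneg.2 h)
  refine ⟨D, fun x => ?_⟩
  rw [← re_inner_adjoint_comp_self D, ← hD, sub_apply, inner_sub_left,
    Complex.sub_re, re_inner_adjoint_comp_self, re_inner_adjoint_comp_self]
  simp

/-- Interpolation: a form below the compression `L* G L` of a positive operator `G` is itself the
compression of an operator between `0` and `G`. -/
theorem exists_between_compression_eq {G D L : H →L[ℂ] H} (hG : 0 ≤ G) (hD : 0 ≤ D)
    (h : D ≤ ContinuousLinearMap.adjoint L ∘L G ∘L L) :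
    ∃ F, 0 ≤ F ∧ F ≤ G ∧ ContinuousLinearMap.adjoint L ∘L F ∘L L = D := by
  obtain ⟨g, rfl⟩ := exists_adjoint_comp_self_eq hG
  obtain ⟨d, rfl⟩ := exists_adjoint_comp_self_eq hD
  have hdg : ∀ x, ‖d x‖ ≤ ‖(g ∘L L) x‖ := by
    rw [← adjoint_comp_self_le_iff, ContinuousLinearMap.adjoint_comp]
    exact h
  obtain ⟨C, hC, hCd⟩ := exists_contraction_comp_eq (g ∘L L) d hdg
  refine ⟨ContinuousLinearMap.adjoint (C ∘L g) ∘L (C ∘L g), ?_, ?_, ?_⟩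
  · exact (ContinuousLinearMap.nonneg_iff_isPositive _).2
      (ContinuousLinearMap.isPositive_adjoint_comp_self _)
  · refine adjoint_comp_self_le_iff.2 fun x => ?_
    exact (C.le_of_opNorm_le hC (g x)).trans (one_mul _).le
  · have : d = (C ∘L g) ∘L L := by ext x; exact (hCd x).symm
    rw [this, ContinuousLinearMap.adjoint_comp (C ∘L g) L]
    rfl

/-- A bounded increasing sequence of positive operators converges strongly. -/
theorem exists_tendsto_of_monotone {B : ℕ → H →L[ℂ] H} (hB : Monotone B) (h0 : ∀ n, 0 ≤ B n)
    {a : ℝ} (ha : ∀ n, ‖B n‖ ≤ a) :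
    ∃ L : H →L[ℂ] H, ∀ x, Filter.Tendsto (fun n => B n x) Filter.atTop (nhds (L x)) := by
  have key : ∀ m n, m ≤ n → ∀ x, ‖B n x - B m x‖ ^ 2 ≤
      a * ((⟪B n x, x⟫_ℂ).re - (⟪B m x, x⟫_ℂ).re) := by
    intro m n hmn x
    have hC : 0 ≤ B n - B m := sub_nonneg.2 (hB hmn)
    have hle : B n - B m ≤ B n := sub_le_self _ (h0 m)
    have hnorm : ‖B n - B m‖ ≤ a :=
      (CStarAlgebra.norm_le_norm_of_nonneg_of_le hC hle).trans (ha n)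
    obtain ⟨R, hR⟩ := exists_adjoint_comp_self_eq hC
    have h1 : (⟪B n x, x⟫_ℂ).re - (⟪B m x, x⟫_ℂ).re = ‖R x‖ ^ 2 := by
      rw [← re_inner_adjoint_comp_self R, ← hR, sub_apply, inner_sub_left,
        Complex.sub_re]
    have h2 : ‖R‖ * ‖R‖ ≤ a := by
      rw [← ContinuousLinearMap.norm_adjoint_comp_self R, ← hR]; exact hnorm
    have h3 : ‖B n x - B m x‖ ≤ ‖R‖ * ‖R x‖ := by
      rw [← sub_apply, hR, ← LinearIsometryEquiv.norm_map
        ContinuousLinearMap.adjoint R]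
      exact (ContinuousLinearMap.adjoint R).le_opNorm (R x)
    rw [h1]
    calc ‖B n x - B m x‖ ^ 2 ≤ (‖R‖ * ‖R x‖) ^ 2 := by gcongr
      _ = (‖R‖ * ‖R‖) * ‖R x‖ ^ 2 := by ring
      _ ≤ a * ‖R x‖ ^ 2 := by gcongr
  have ha0 : 0 ≤ a := (norm_nonneg _).trans (ha 0)
  have hcauchy : ∀ x, CauchySeq fun n => B n x := by
    intro x
    have hq : Monotone fun n => (⟪B n x, x⟫_ℂ).re := fun m n hmn => re_inner_le_of_le (hB hmn) x
    have hbdd : BddAbove (Set.range fun n => (⟪B n x, x⟫_ℂ).re) := by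
      refine ⟨a * ‖x‖ * ‖x‖, ?_⟩
      rintro _ ⟨n, rfl⟩
      calc (⟪B n x, x⟫_ℂ).re ≤ ‖⟪B n x, x⟫_ℂ‖ := Complex.re_le_norm _
        _ ≤ ‖B n x‖ * ‖x‖ := norm_inner_le_norm _ _
        _ ≤ a * ‖x‖ * ‖x‖ := by gcongr; exact (B n).le_of_opNorm_le (ha n) x
    have hqc := (tendsto_atTop_ciSup hq hbdd).cauchySeq
    rw [Metric.cauchySeq_iff'] at hqc ⊢
    intro ε hε
    obtain ⟨N, hN⟩ := hqc (ε ^ 2 / (a + 1)) (by positivity)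
    refine ⟨N, fun n hn => ?_⟩
    have h1 := hN n hn
    rw [Real.dist_eq] at h1
    have h2 := key N n hn x
    rw [dist_eq_norm]
    have h3 := (le_abs_self _).trans_lt h1
    rw [lt_div_iff₀ (by positivity)] at h3
    have h4 : 0 ≤ (⟪B n x, x⟫_ℂ).re - (⟪B N x, x⟫_ℂ).re := sub_nonneg.2 (hq hn)
    refine lt_of_pow_lt_pow_left₀ 2 hε.le ?_
    nlinarith
  choose L hL using fun x => cauchySeq_tendsto_of_complete (hcauchy x)
  exact ⟨continuousLinearMapOfTendsto B (tendsto_pi_nhds.2 hL), hL⟩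

end Positivity

/-! ### Invariant majorants -/

section InvariantMajorant

variable {H : Type*} [NormedAddCommGroup H] [InnerProductSpace ℂ H] [CompleteSpace H]

theorem norm_le_of_le_algebraMap {B : H →L[ℂ] H} {a : ℝ} (hB : 0 ≤ B) (ha : 0 ≤ a)
    (h : B ≤ algebraMap ℝ (H →L[ℂ] H) a) : ‖B‖ ≤ a :=
  (CStarAlgebra.norm_le_iff_le_algebraMap B ha hB).2 h

/-- One step of the construction of an invariant majorant: if `T* B T ≤ B ≤ a` and `T` is
expansive, then `B` is the compression `T* B' T` of some `B'` with `B ≤ B' ≤ a`. Since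
`T* (a - B') T = a T* T - B` is prescribed, this is interpolation for `a - B'`. -/
theorem exists_le_compression_eq {T B : H →L[ℂ] H} {a : ℝ} (ha : 0 ≤ a) (hT : 0 ≤ Delta T)
    (hTB : ContinuousLinearMap.adjoint T ∘L B ∘L T ≤ B) (hBa : B ≤ algebraMap ℝ (H →L[ℂ] H) a) :
    ∃ B', B ≤ B' ∧ B' ≤ algebraMap ℝ (H →L[ℂ] H) a ∧
      ContinuousLinearMap.adjoint T ∘L B' ∘L T = B := by
  set c := algebraMap ℝ (H →L[ℂ] H) a with hc
  have hconj : ∀ X Y : H →L[ℂ] H, ContinuousLinearMap.adjoint T ∘L (X - Y) ∘L T =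
      ContinuousLinearMap.adjoint T ∘L X ∘L T - ContinuousLinearMap.adjoint T ∘L Y ∘L T := by
    intro X Y
    rw [ContinuousLinearMap.sub_comp, ContinuousLinearMap.comp_sub]
  have hcT : c ≤ ContinuousLinearMap.adjoint T ∘L c ∘L T := by
    have h : ContinuousLinearMap.adjoint T ∘L c ∘L T - c = a • Delta T := by
      ext x
      simp [hc, Delta, Algebra.algebraMap_eq_smul_one, smul_sub]
    rw [← sub_nonneg, h]
    exact smul_nonneg ha hT
  obtain ⟨F, hF0, hF, hFT⟩ := exists_between_compression_eq (G := c - B)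
    (D := ContinuousLinearMap.adjoint T ∘L c ∘L T - B) (L := T) (sub_nonneg.2 hBa)
    (sub_nonneg.2 (hBa.trans hcT)) (by rw [hconj]; exact sub_le_sub_left hTB _)
  refine ⟨c - F, le_sub_comm.1 hF, sub_le_self _ hF0, ?_⟩
  rw [hconj, hFT, sub_sub_cancel]

/-- If `T` is an expansive `A`-contraction, then `A` is dominated by an operator `B` with
`T* B T = B` and the same norm bound. -/
theorem exists_invariant_majorant {T A : H →L[ℂ] H} (hA : 0 ≤ A)
    (hTA : ContinuousLinearMap.adjoint T ∘L A ∘L T ≤ A) (hT : 0 ≤ Delta T) :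
    ∃ B, A ≤ B ∧ ContinuousLinearMap.adjoint T ∘L B ∘L T = B ∧ ‖B‖ ≤ ‖A‖ := by
  let P : (H →L[ℂ] H) → Prop := fun B => 0 ≤ B ∧
    ContinuousLinearMap.adjoint T ∘L B ∘L T ≤ B ∧ B ≤ algebraMap ℝ (H →L[ℂ] H) ‖A‖
  have hstep : ∀ B : {B // P B}, ∃ B' : {B // P B}, B.1 ≤ B'.1 ∧
      ContinuousLinearMap.adjoint T ∘L B'.1 ∘L T = B.1 := by
    rintro ⟨B, hB0, hTB, hBa⟩
    obtain ⟨B', h1, h2, h3⟩ := exists_le_compression_eq (norm_nonneg A) hT hTB hBa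
    exact ⟨⟨B', hB0.trans h1, h3.trans_le h1, h2⟩, h1, h3⟩
  choose next hle hnext using hstep
  let B : ℕ → {B // P B} := fun n => next^[n]
    ⟨A, hA, hTA, (IsSelfAdjoint.of_nonneg hA).le_algebraMap_norm_self⟩
  have hsucc : ∀ n, B (n + 1) = next (B n) := fun n => Function.iterate_succ_apply' _ _ _
  have hmono : Monotone fun n => (B n).1 :=
    monotone_nat_of_le_succ fun n => by rw [hsucc]; exact hle _
  have hnorm : ∀ n, ‖(B n).1‖ ≤ ‖A‖ := fun n =>
    norm_le_of_le_algebraMap (B n).2.1 (norm_nonneg A) (B n).2.2.2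
  obtain ⟨L, hL⟩ := exists_tendsto_of_monotone hmono (fun n => (B n).2.1) hnorm
  have hsa : IsSelfAdjoint L := by
    rw [ContinuousLinearMap.isSelfAdjoint_iff_isSymmetric]
    intro x y
    refine tendsto_nhds_unique ((hL x).inner tendsto_const_nhds)
      ((tendsto_const_nhds.inner (hL y)).congr fun n => ?_)
    exact ((IsSelfAdjoint.of_nonneg (B n).2.1).isSymmetric x y).symm
  refine ⟨L, ?_, ?_, ?_⟩
  · refine (le_iff_re_inner_le (IsSelfAdjoint.of_nonneg hA) hsa).2 fun x => ?_
    refine ge_of_tendsto' (Complex.continuous_re.continuousAt.tendsto.comp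
      ((hL x).inner tendsto_const_nhds)) fun n => ?_
    exact re_inner_le_of_le (hmono (Nat.zero_le n)) x
  · ext x
    refine tendsto_nhds_unique ?_ (hL x)
    refine (((ContinuousLinearMap.adjoint T).continuous.tendsto _).comp
      ((hL (T x)).comp (Filter.tendsto_add_atTop_nat 1))).congr fun n => ?_
    have h := congrArg (fun X : H →L[ℂ] H => X x) (hnext (B n))
    rw [← hsucc] at h
    exact h
  · refine L.opNorm_le_bound (norm_nonneg A) fun x => ?_
    exact le_of_tendsto' (hL x).norm fun n => (B n).1.le_of_opNorm_le (hnorm n) x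

end InvariantMajorant

/-! ### The sequence space and direct sums -/

section SequenceSpace

variable {X : Type*} [NormedAddCommGroup X]

/-- The Hilbert space `ℓ²(ℕ, X)` of square summable sequences in `X`. -/
abbrev SeqSpace (X : Type*) [NormedAddCommGroup X] : Type _ := lp (fun _ : ℕ => X) 2

theorem hasSum_norm_sq (s : SeqSpace X) : HasSum (fun n => ‖s n‖ ^ 2) (‖s‖ ^ 2) := by
  have h := lp.hasSum_norm (p := 2) (by norm_num) s
  simpa using h

theorem memlp_two_of_summable {f : ℕ → X} (h : Summable fun n => ‖f n‖ ^ 2) :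
    Memℓp f 2 :=
  memℓp_gen (by simpa using h)

/-- The sequence `x, s 0, s 1, …`. -/
def consSeq (x : X) (s : SeqSpace X) : SeqSpace X :=
  ⟨fun n => Nat.casesOn n x fun m => s m, memlp_two_of_summable (by
    rw [← summable_nat_add_iff 1]
    exact (hasSum_norm_sq s).summable)⟩

/-- The sequence `s 1, s 2, …`. -/
def tailSeq (s : SeqSpace X) : SeqSpace X :=
  ⟨fun n => s (n + 1), memlp_two_of_summable
    ((summable_nat_add_iff 1).2 (hasSum_norm_sq s).summable)⟩

@[simp] theorem consSeq_zero (x : X) (s : SeqSpace X) : consSeq x s 0 = x := rfl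

@[simp] theorem consSeq_succ (x : X) (s : SeqSpace X) (n : ℕ) : consSeq x s (n + 1) = s n := rfl

theorem norm_sq_eq_add_tailSeq (s : SeqSpace X) : ‖s‖ ^ 2 = ‖s 0‖ ^ 2 + ‖tailSeq s‖ ^ 2 := by
  have h := hasSum_norm_sq s
  rw [← h.tsum_eq, h.summable.tsum_eq_zero_add, ← (hasSum_norm_sq (tailSeq s)).tsum_eq]
  rfl

theorem norm_sq_consSeq (x : X) (s : SeqSpace X) : ‖consSeq x s‖ ^ 2 = ‖x‖ ^ 2 + ‖s‖ ^ 2 :=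
  norm_sq_eq_add_tailSeq (consSeq x s)

variable [InnerProductSpace ℂ X]

variable (X) in
/-- `consSeq` as a bounded operator `X ⊕ ℓ²(ℕ, X) → ℓ²(ℕ, X)`. -/
noncomputable def consL : WithLp 2 (X × SeqSpace X) →L[ℂ] SeqSpace X :=
  LinearIsometry.toContinuousLinearMap
    { toFun := fun z => consSeq z.fst z.snd
      map_add' := fun z w => by ext n; cases n <;> rfl
      map_smul' := fun c z => by ext n; cases n <;> rfl
      norm_map' := fun z => by
        rw [← sq_eq_sq₀ (norm_nonneg _) (norm_nonneg _)]
        exact (norm_sq_consSeq z.fst z.snd).trans (WithLp.prod_norm_sq_eq_of_L2 z).symm }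

variable (X) in
/-- `tailSeq`, the backward shift on `ℓ²(ℕ, X)`. -/
noncomputable def tailL : SeqSpace X →L[ℂ] SeqSpace X :=
  LinearMap.mkContinuous
    { toFun := tailSeq
      map_add' := fun s t => by ext n; rfl
      map_smul' := fun c s => by ext n; rfl } 1 fun s => by
    rw [one_mul, ← sq_le_sq₀ (norm_nonneg _) (norm_nonneg _), norm_sq_eq_add_tailSeq s]
    exact le_add_of_nonneg_left (sq_nonneg _)

end SequenceSpace

section Pairing

theorem norm_sq_toLp {X Y : Type*} [NormedAddCommGroup X] [NormedAddCommGroup Y]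
    (x : X) (y : Y) :
    ‖(WithLp.toLp 2 (x, y) : WithLp 2 (X × Y))‖ ^ 2 = ‖x‖ ^ 2 + ‖y‖ ^ 2 :=
  WithLp.prod_norm_sq_eq_of_L2 _

variable {X Y Z : Type*} [NormedAddCommGroup X] [InnerProductSpace ℂ X]
  [NormedAddCommGroup Y] [InnerProductSpace ℂ Y] [NormedAddCommGroup Z] [InnerProductSpace ℂ Z]

/-- The operator `z ↦ (f z, g z)` into the Hilbert space direct sum. -/
noncomputable def pairL (f : Z →L[ℂ] X) (g : Z →L[ℂ] Y) : Z →L[ℂ] WithLp 2 (X × Y) :=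
  (WithLp.prodContinuousLinearEquiv 2 ℂ X Y).symm.toContinuousLinearMap ∘L f.prod g

theorem norm_sq_pairL (f : Z →L[ℂ] X) (g : Z →L[ℂ] Y) (z : Z) :
    ‖pairL f g z‖ ^ 2 = ‖f z‖ ^ 2 + ‖g z‖ ^ 2 :=
  WithLp.prod_norm_sq_eq_of_L2 _

variable (X Y) in
/-- The isometric inclusion of the first summand in `X ⊕ Y`. -/
noncomputable def inlLI : X →ₗᵢ[ℂ] WithLp 2 (X × Y) where
  toLinearMap := (pairL (ContinuousLinearMap.id ℂ X) (0 : X →L[ℂ] Y)).toLinearMap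
  norm_map' x := by
    rw [← sq_eq_sq₀ (norm_nonneg _) (norm_nonneg _)]
    exact (norm_sq_pairL _ _ x).trans (by simp)

end Pairing

/-! ### Isometric and unitary extensions -/

section Dilation

/-- Isometric dilation: if `‖c h‖² = ‖a h‖² + ‖b h‖²`, then the partially defined isometry
`(a h, b h) ↦ c h` from `X ⊕ Y` to `X` extends to a row isometry `(V, F) : K₀ ⊕ Y → K₀` on a
Hilbert space `K₀` containing `X`. -/
theorem exists_row_isometry {H X Y : Type u} [NormedAddCommGroup H] [InnerProductSpace ℂ H]
    [NormedAddCommGroup X] [InnerProductSpace ℂ X] [CompleteSpace X]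
    [NormedAddCommGroup Y] [InnerProductSpace ℂ Y] [CompleteSpace Y]
    (a c : H →L[ℂ] X) (b : H →L[ℂ] Y) (h : ∀ x, ‖c x‖ ^ 2 = ‖a x‖ ^ 2 + ‖b x‖ ^ 2) :
    ∃ (K₀ : Type u) (_ : NormedAddCommGroup K₀) (_ : InnerProductSpace ℂ K₀) (_ : CompleteSpace K₀)
      (J : X →ₗᵢ[ℂ] K₀) (V : K₀ →L[ℂ] K₀) (F : Y →L[ℂ] K₀),
      (∀ k y, ‖V k + F y‖ ^ 2 = ‖k‖ ^ 2 + ‖y‖ ^ 2) ∧ ∀ x, V (J (a x)) + F (b x) = J (c x) := by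
  have hab : ∀ x, ‖pairL a b x‖ ^ 2 = ‖c x‖ ^ 2 := fun x => by rw [norm_sq_pairL, h]
  obtain ⟨C, hC, hCc⟩ := exists_contraction_comp_eq (pairL a b) c fun x =>
    (sq_le_sq₀ (norm_nonneg _) (norm_nonneg _)).1 (hab x).ge
  obtain ⟨D, hD⟩ := exists_defect fun z => (C.le_of_opNorm_le hC z).trans (one_mul _).le
  have hD0 : ∀ x, D (pairL a b x) = 0 := fun x => by
    have h1 := hD (pairL a b x)
    rw [hCc, hab, add_eq_left, sq_eq_zero_iff, norm_eq_zero] at h1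
    exact h1
  -- On `X ⊕ ℓ²(ℕ, X ⊕ Y)`, let `(V, F)` send `((x, s), y)` to
  -- `(C (x, y), (D (x, y), s 0, s 1, …))`; here `D` vanishes at every `(a h, b h)`.
  let S := SeqSpace (WithLp 2 (X × Y))
  let i₁ : WithLp 2 (X × S) →L[ℂ] WithLp 2 (X × Y) :=
    pairL (WithLp.fstL 2 ℂ X S) 0
  let i₂ : Y →L[ℂ] WithLp 2 (X × Y) := pairL 0 (ContinuousLinearMap.id ℂ Y)
  let V : WithLp 2 (X × S) →L[ℂ] WithLp 2 (X × S) :=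
    pairL (C ∘L i₁) (consL _ ∘L pairL (D ∘L i₁) (WithLp.sndL 2 ℂ X S))
  let F : Y →L[ℂ] WithLp 2 (X × S) := pairL (C ∘L i₂) (consL _ ∘L pairL (D ∘L i₂) 0)
  have hi : ∀ (k : WithLp 2 (X × S)) (y : Y), i₁ k + i₂ y = WithLp.toLp 2 (k.fst, y) := by
    intro k y
    refine (WithLp.equiv 2 (X × Y)).injective (Prod.ext ?_ ?_)
    · exact add_zero k.fst
    · exact zero_add y
  have hVF : ∀ k y, V k + F y = WithLp.toLp 2 (C (WithLp.toLp 2 (k.fst, y)),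
      consSeq (D (WithLp.toLp 2 (k.fst, y))) k.snd) := by
    intro k y
    rw [← hi, map_add, map_add]
    refine (WithLp.equiv 2 (X × S)).injective (Prod.ext rfl ?_)
    refine lp.ext (funext fun n => ?_)
    cases n with
    | zero => rfl
    | succ n => exact add_zero (k.snd n)
  refine ⟨WithLp 2 (X × S), inferInstance, inferInstance, inferInstance, inlLI X S, V, F, ?_, ?_⟩
  · intro k y
    rw [hVF, norm_sq_toLp, norm_sq_consSeq, ← add_assoc, hD, norm_sq_toLp,
      WithLp.prod_norm_sq_eq_of_L2]
    exact add_right_comm _ _ _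
  · intro x
    rw [hVF]
    have e : WithLp.toLp 2 ((inlLI X S (a x)).fst, b x) = pairL a b x := rfl
    rw [e, hCc, hD0]
    refine (WithLp.equiv 2 (X × S)).injective (Prod.ext rfl ?_)
    refine lp.ext (funext fun n => ?_)
    cases n <;> rfl

/-- Every isometry extends to a unitary operator: with `N = (ran V)ᗮ`, the unitary acts on
`K ⊕ ℓ²(ℕ, N)` by `(x, s) ↦ (V x + s 0, (s 1, s 2, …))`. -/
theorem exists_unitary_extension {K : Type u} [NormedAddCommGroup K] [InnerProductSpace ℂ K]
    [CompleteSpace K] (V : K →ₗᵢ[ℂ] K) :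
    ∃ (K₁ : Type u) (_ : NormedAddCommGroup K₁) (_ : InnerProductSpace ℂ K₁) (_ : CompleteSpace K₁)
      (J : K →ₗᵢ[ℂ] K₁) (U : K₁ →L[ℂ] K₁), U ∈ unitary (K₁ →L[ℂ] K₁) ∧ ∀ k, U (J k) = J (V k) := by
  let R : Submodule ℂ K := LinearMap.range V.toLinearMap
  let S := SeqSpace Rᗮ
  have : CompleteSpace R := V.isometry.isUniformInducing.isComplete_range.completeSpace_coe
  let U : WithLp 2 (K × S) →L[ℂ] WithLp 2 (K × S) :=
    pairL (V.toContinuousLinearMap ∘L WithLp.fstL 2 ℂ K S +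
      Rᗮ.subtypeL ∘L lp.evalCLM ℂ (fun _ : ℕ => Rᗮ) 2 0 ∘L WithLp.sndL 2 ℂ K S)
      (tailL _ ∘L WithLp.sndL 2 ℂ K S)
  have hU : ∀ z, U z = WithLp.toLp 2 (V z.fst + (z.snd 0 : K), tailSeq z.snd) := fun z => rfl
  have hnorm : ∀ z, ‖U z‖ = ‖z‖ := fun z => by
    have horth : ⟪V z.fst, (z.snd 0 : K)⟫_ℂ = 0 := (z.snd 0).2 _ ⟨z.fst, rfl⟩
    rw [← sq_eq_sq₀ (norm_nonneg _) (norm_nonneg _), hU, norm_sq_toLp,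
      WithLp.prod_norm_sq_eq_of_L2 z, norm_sq_eq_add_tailSeq z.snd, ← add_assoc]
    congr 1
    have := norm_add_sq_eq_norm_sq_add_norm_sq_of_inner_eq_zero _ _ horth
    simp only [← sq, V.norm_map] at this
    exact this
  have hsurj : Function.Surjective U := fun w => by
    obtain ⟨_, ⟨x, rfl⟩, n, hn, hw⟩ := R.exists_add_mem_mem_orthogonal w.fst
    refine ⟨WithLp.toLp 2 (x, consSeq ⟨n, hn⟩ w.snd), ?_⟩
    exact (WithLp.equiv 2 (K × S)).injective (Prod.ext hw.symm rfl)
  let e : WithLp 2 (K × S) ≃ₗᵢ[ℂ] WithLp 2 (K × S) :=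
    LinearIsometryEquiv.ofSurjective ⟨U.toLinearMap, hnorm⟩ hsurj
  refine ⟨WithLp 2 (K × S), inferInstance, inferInstance, inferInstance, inlLI K S, U, ?_, ?_⟩
  · exact (Unitary.linearIsometryEquiv.symm e).2
  · intro k
    rw [hU]
    refine (WithLp.equiv 2 (K × S)).injective (Prod.ext (add_zero (V k)) rfl)

/-- If `‖c h‖ = ‖a h‖` for all `h`, then `a h ↦ c h` extends to a unitary operator on a larger
space: an isometric dilation followed by a unitary extension. -/
theorem exists_unitary_of_norm_eq {H X : Type u} [NormedAddCommGroup H] [InnerProductSpace ℂ H]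
    [NormedAddCommGroup X] [InnerProductSpace ℂ X] [CompleteSpace X]
    (a c : H →L[ℂ] X) (h : ∀ x, ‖c x‖ = ‖a x‖) :
    ∃ (K₁ : Type u) (_ : NormedAddCommGroup K₁) (_ : InnerProductSpace ℂ K₁) (_ : CompleteSpace K₁)
      (J : X →ₗᵢ[ℂ] K₁) (U : K₁ →L[ℂ] K₁), U ∈ unitary (K₁ →L[ℂ] K₁) ∧
        ∀ x, U (J (a x)) = J (c x) := by
  obtain ⟨K, _, _, _, J, V, F, hVF, hV⟩ := exists_row_isometry a c (0 : H →L[ℂ] X)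
    fun x => by simp [h]
  obtain ⟨K₁, i1, i2, i3, J₁, U, hU, hUV⟩ := exists_unitary_extension
    (⟨V.toLinearMap, fun k => by
      have := hVF k 0
      rw [← sq_eq_sq₀ (norm_nonneg _) (norm_nonneg _)]
      simpa using this⟩ : K →ₗᵢ[ℂ] K)
  refine ⟨K₁, i1, i2, i3, J₁.comp J, U, hU, fun x => ?_⟩
  have h1 := hV x
  rw [zero_apply, map_zero, add_zero] at h1
  change U (J₁ (J (a x))) = J₁ (J (c x))
  rw [hUV, ← h1]
  rfl

end Dilation

/-! ### Invariant majorants and block extensions, compression of liftings -/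

section Implications

variable {H : Type u} [NormedAddCommGroup H] [InnerProductSpace ℂ H] [CompleteSpace H]

theorem norm_sq_eq_of_Delta_eq {T d : H →L[ℂ] H}
    (hd : Delta T = ContinuousLinearMap.adjoint d ∘L d) (x : H) :
    ‖T x‖ ^ 2 = ‖x‖ ^ 2 + ‖d x‖ ^ 2 := by
  have h := re_inner_Delta T x
  rw [hd, re_inner_adjoint_comp_self] at h
  linarith

theorem norm_apply_eq_of_invariant {T R : H →L[ℂ] H}
    (h : ContinuousLinearMap.adjoint T ∘L (ContinuousLinearMap.adjoint R ∘L R) ∘L T =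
      ContinuousLinearMap.adjoint R ∘L R) (x : H) : ‖R (T x)‖ = ‖R x‖ := by
  rw [← sq_eq_sq₀ (norm_nonneg _) (norm_nonneg _), ← re_inner_adjoint_comp_self R x, ← h,
    ← re_inner_adjoint_comp_self R (T x)]
  simp only [ContinuousLinearMap.comp_apply, ContinuousLinearMap.adjoint_inner_left]

/-- The block extension obtained from an invariant majorant `B` of `Δ_T`. With `B = R* R` and
`δ Z₁ = R`, the operator `Z₁` intertwines `T` with a unitary `U`; with `Z₀* Z₀ = I - Z₁* Z₁`
and `Δ_T = d* d`, the identity `‖Z₀ T h‖² = ‖Z₀ h‖² + ‖d h‖²` produces `V`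
and, after factoring `d` through `R`, also `E`. -/
theorem hasBlockExtension_of_invariant {T B : H →L[ℂ] H} {δ : ℝ} (hδ : 0 ≤ δ)
    (hT : 0 ≤ Delta T) (hTB : Delta T ≤ B)
    (hB : ContinuousLinearMap.adjoint T ∘L B ∘L T = B) (hBδ : ‖B‖ ≤ δ ^ 2)
    (hTδ : Real.sqrt ‖Delta T‖ ≤ δ) : HasBlockExtension T δ := by
  obtain ⟨R, rfl⟩ := exists_adjoint_comp_self_eq (hT.trans hTB)
  obtain ⟨d, hd⟩ := exists_adjoint_comp_self_eq hT
  have hRT := norm_apply_eq_of_invariant hB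
  have hdR : ∀ x, ‖d x‖ ≤ ‖R x‖ := adjoint_comp_self_le_iff.1 (hd ▸ hTB)
  have hRδ : ‖R‖ ≤ δ := by
    rw [← sq_le_sq₀ (norm_nonneg _) hδ, sq ‖R‖, ← ContinuousLinearMap.norm_adjoint_comp_self R]
    exact hBδ
  -- For `δ = 0` the junk value `δ⁻¹ = 0` is harmless: `R = 0` then.
  let Z₁ : H →L[ℂ] H := ((δ : ℂ)⁻¹) • R
  have hZR : ∀ x, (δ : ℂ) • Z₁ x = R x := fun x => by
    rcases eq_or_ne δ 0 with h0 | h0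
    · have : R = 0 := norm_le_zero_iff.1 (h0 ▸ hRδ)
      simp [Z₁, this]
    · exact smul_inv_smul₀ (Complex.ofReal_ne_zero.2 h0) (R x)
  have hZnorm : ∀ x, ‖Z₁ x‖ = δ⁻¹ * ‖R x‖ := fun x => by
    simp [Z₁, norm_smul, abs_of_nonneg hδ]
  have hZ1 : ∀ x, ‖Z₁ x‖ ≤ ‖x‖ := fun x => by
    rw [hZnorm]
    calc δ⁻¹ * ‖R x‖ ≤ δ⁻¹ * (δ * ‖x‖) := by gcongr; exact R.le_of_opNorm_le hRδ x
      _ = (δ⁻¹ * δ) * ‖x‖ := (mul_assoc _ _ _).symm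
      _ ≤ ‖x‖ := mul_le_of_le_one_left (norm_nonneg _) inv_mul_le_one
  have hZT : ∀ x, ‖Z₁ (T x)‖ = ‖Z₁ x‖ := fun x => by rw [hZnorm, hZnorm, hRT]
  obtain ⟨Z₀, hZ₀⟩ := exists_defect hZ1
  obtain ⟨K₁, _, _, _, J₁, U, hU, hUJ⟩ := exists_unitary_of_norm_eq Z₁ (Z₁ ∘L T) hZT
  obtain ⟨K₀, _, _, _, J₀, V, F, hVF, hVJ⟩ := exists_row_isometry Z₀ (Z₀ ∘L T) d fun x => by
    have h1 := hZ₀ (T x)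
    have h2 := hZ₀ x
    have h3 := norm_sq_eq_of_Delta_eq hd x
    rw [hZT] at h1
    change ‖Z₀ (T x)‖ ^ 2 = _
    linarith
  obtain ⟨E, hE, hEd⟩ := exists_contraction_comp_eq (J₁.toContinuousLinearMap ∘L R) d fun x =>
    (hdR x).trans (J₁.norm_map (R x)).ge
  have hV : ∀ k, ‖V k‖ = ‖k‖ := fun k => by
    rw [← sq_eq_sq₀ (norm_nonneg _) (norm_nonneg _)]
    simpa using hVF k 0
  have hF : ∀ y, ‖F y‖ = ‖y‖ := fun y => by
    rw [← sq_eq_sq₀ (norm_nonneg _) (norm_nonneg _)]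
    simpa using hVF 0 y
  -- The real part of `⟪V k, F y⟫` vanishes by the Pythagorean identity, the imaginary part by
  -- the same identity for `I • k`.
  have hre : ∀ k y, (⟪V k, F y⟫_ℂ).re = 0 := fun k y => by
    have h1 := hVF k y
    have h2 := norm_add_sq (𝕜 := ℂ) (V k) (F y)
    rw [hV, hF, RCLike.re_to_complex] at h2
    linarith
  have horth : ∀ k y, ⟪V k, F y⟫_ℂ = 0 := fun k y => by
    refine Complex.ext (hre k y) ?_
    have := hre (Complex.I • k) y
    rw [map_smul, inner_smul_left] at this
    simpa using this
  let Z : H →ₗᵢ[ℂ] WithLp 2 (K₀ × K₁) :=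
    { toLinearMap := (pairL (J₀.toContinuousLinearMap ∘L Z₀)
        (J₁.toContinuousLinearMap ∘L Z₁)).toLinearMap
      norm_map' := fun x => by
        rw [← sq_eq_sq₀ (norm_nonneg _) (norm_nonneg _), ← hZ₀ x, ← J₀.norm_map (Z₀ x),
          ← J₁.norm_map (Z₁ x), add_comm]
        exact norm_sq_pairL _ _ x }
  refine ⟨K₀, inferInstance, inferInstance, inferInstance, K₁, inferInstance, inferInstance,
    inferInstance, V, F ∘L E, U, Z, AddMonoidHomClass.isometry_of_norm V hV, hU, ?_, ?_, hTδ, ?_⟩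
  · refine (ContinuousLinearMap.opNorm_comp_le _ _).trans
      (mul_le_one₀ ?_ (norm_nonneg _) hE)
    exact F.opNorm_le_bound zero_le_one fun y => by rw [hF, one_mul]
  · ext y
    refine ext_inner_left ℂ fun k => ?_
    simpa [ContinuousLinearMap.adjoint_inner_right] using horth k (E y)
  · ext x
    change Z (T x) = blockUpper V ((δ : ℂ) • F ∘L E) U (Z x)
    rw [blockUpper_apply]
    refine (WithLp.equiv 2 (K₀ × K₁)).injective (Prod.ext ?_ ?_)
    · change J₀ (Z₀ (T x)) = V (J₀ (Z₀ x)) + (δ : ℂ) • F (E (J₁ (Z₁ x)))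
      have h1 := hVJ x
      have h2 : E (J₁ (R x)) = d x := hEd x
      rw [← map_smul, ← map_smul, ← map_smul, hZR, h2, h1]
      rfl
    · exact (hUJ x).symm

/-- A block extension provides an invariant majorant of `Δ_T`, namely `δ² Z₁* Z₁` where `Z₁` is
the second component of the embedding. -/
theorem exists_invariant_of_hasBlockExtension {T : H →L[ℂ] H} {δ : ℝ}
    (h : HasBlockExtension T δ) :
    ∃ A : H →L[ℂ] H, IsAContraction T A ∧ Delta T ≤ A ∧ 0 ≤ Delta T := by
  obtain ⟨K₀, _, _, _, K₁, _, _, _, V, E, U, Z, hV, hU, hE, hVE, -, hZ⟩ := h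
  have hVn : ∀ k, ‖V k‖ = ‖k‖ := fun k => by
    simpa using hV.dist_eq k 0
  have hUn : ∀ k, ‖U k‖ = ‖k‖ := fun k => (Unitary.linearIsometryEquiv ⟨U, hU⟩).norm_map k
  let R : H →L[ℂ] K₁ := (δ : ℂ) • (WithLp.sndL 2 ℂ K₀ K₁ ∘L Z.toContinuousLinearMap)
  have hZT : ∀ x, Z (T x) =
      WithLp.toLp 2 (V (Z x).fst + (δ : ℂ) • E (Z x).snd, U (Z x).snd) := fun x =>
    congrArg (fun X : H →L[ℂ] WithLp 2 (K₀ × K₁) => X x) hZ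
  have hR : ∀ x, R x = (δ : ℂ) • (Z x).snd := fun x => rfl
  have hRT : ∀ x, ‖R (T x)‖ = ‖R x‖ := fun x => by
    rw [hR, hR, norm_smul, norm_smul, hZT]
    congr 1
    exact hUn _
  have horth : ∀ k y, ⟪V k, (δ : ℂ) • E y⟫_ℂ = 0 := fun k y => by
    have h1 : ContinuousLinearMap.adjoint V (E y) = 0 :=
      congrArg (fun X : K₁ →L[ℂ] K₀ => X y) hVE
    rw [inner_smul_right, ← ContinuousLinearMap.adjoint_inner_right, h1, inner_zero_right,
      mul_zero]
  have hT : ∀ x, ‖T x‖ ^ 2 = ‖x‖ ^ 2 + ‖(δ : ℂ) • E (Z x).snd‖ ^ 2 := fun x => by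
    have h1 := norm_add_sq_eq_norm_sq_add_norm_sq_of_inner_eq_zero _ _
      (horth (Z x).fst (Z x).snd)
    rw [← sq, ← sq, ← sq, hVn] at h1
    rw [← Z.norm_map, hZT, norm_sq_toLp, h1, hUn, ← Z.norm_map x,
      WithLp.prod_norm_sq_eq_of_L2 (Z x)]
    exact add_right_comm _ _ _
  refine ⟨ContinuousLinearMap.adjoint R ∘L R, ⟨(ContinuousLinearMap.nonneg_iff_isPositive _).2
    (ContinuousLinearMap.isPositive_adjoint_comp_self _), ?_⟩, ?_, ?_⟩
  · have : ContinuousLinearMap.adjoint T ∘L (ContinuousLinearMap.adjoint R ∘L R) ∘L T =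
        ContinuousLinearMap.adjoint (R ∘L T) ∘L (R ∘L T) := by
      rw [ContinuousLinearMap.adjoint_comp]; rfl
    rw [this]
    exact adjoint_comp_self_le_iff.2 fun x => (hRT x).le
  · refine (le_iff_re_inner_le (isSelfAdjoint_Delta T)
      (isSelfAdjoint_adjoint_comp_self R)).2 fun x => ?_
    rw [re_inner_Delta, re_inner_adjoint_comp_self, hT, add_sub_cancel_left, hR, norm_smul,
      norm_smul]
    gcongr
    exact (E.le_of_opNorm_le hE _).trans (one_mul _).le
  · refine (le_iff_re_inner_le (IsSelfAdjoint.zero _) (isSelfAdjoint_Delta T)).2 fun x => ?_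
    rw [re_inner_Delta, hT]
    simp

theorem isExpansive_iff {T : H →L[ℂ] H} : IsExpansive T ↔ 0 ≤ Delta T := sub_nonneg.symm

/-- For a type I lifting `S` of an expansive operator, the compression `A` of `Δ_S` to `H`
satisfies `T* A T = A ≥ Δ_T`. -/
theorem exists_of_hasMinimalTypeILifting {T : H →L[ℂ] H} (hT : IsExpansive T)
    (h : HasMinimalTypeILifting T) :
    ∃ A : H →L[ℂ] H, IsAContraction T A ∧ Delta T ≤ A ∧ 0 ≤ Delta T := by
  obtain ⟨K, _, _, _, Z, S, hlift, htwo, htype, -⟩ := h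
  have hΔ := isExpansive_iff.1 hT
  let ζ := Z.toContinuousLinearMap
  have hZZ : ∀ x, ContinuousLinearMap.adjoint ζ (Z x) = x := fun x => by
    refine ext_inner_left ℂ fun y => ?_
    rw [ContinuousLinearMap.adjoint_inner_right]
    exact Z.inner_map_map y x
  have hZS : ∀ k, ContinuousLinearMap.adjoint ζ (S k) = T (ContinuousLinearMap.adjoint ζ k) := by
    intro k
    refine ext_inner_left ℂ fun y => ?_
    have h1 : Z (ContinuousLinearMap.adjoint T y) = ContinuousLinearMap.adjoint S (Z y) :=
      congrArg (fun X : H →L[ℂ] K => X y) hlift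
    rw [ContinuousLinearMap.adjoint_inner_right, ← ContinuousLinearMap.adjoint_inner_left S,
      ← ContinuousLinearMap.adjoint_inner_left T, ContinuousLinearMap.adjoint_inner_right]
    exact congrArg (fun z => ⟪z, k⟫_ℂ) h1.symm
  -- `S h - T h` is orthogonal to `H`, hence killed by `Δ_S`.
  have hker : ∀ x, Delta S (S (Z x)) = Delta S (Z (T x)) := fun x => by
    rw [← sub_eq_zero, ← map_sub]
    refine htype (fun w hw => ?_)
    obtain ⟨y, rfl⟩ := hw
    change ⟪ζ y, _⟫_ℂ = 0
    rw [← ContinuousLinearMap.adjoint_inner_right, map_sub, hZS, hZZ, hZZ, sub_self,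
      inner_zero_right]
  have hSsa : ∀ k l, ⟪Delta S k, l⟫_ℂ = ⟪k, Delta S l⟫_ℂ := fun k l =>
    (isSelfAdjoint_Delta S).isSymmetric k l
  let A : H →L[ℂ] H := ContinuousLinearMap.adjoint ζ ∘L Delta S ∘L ζ
  have hA : ∀ x y, ⟪A x, y⟫_ℂ = ⟪Delta S (Z x), Z y⟫_ℂ := fun x y =>
    ContinuousLinearMap.adjoint_inner_left ζ _ _
  have hAsa : IsSelfAdjoint A := by
    rw [ContinuousLinearMap.isSelfAdjoint_iff_isSymmetric]
    intro x y
    change ⟪A x, y⟫_ℂ = ⟪x, A y⟫_ℂ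
    rw [hA, ← inner_conj_symm x, hA, inner_conj_symm, hSsa]
  have hTA : ContinuousLinearMap.adjoint T ∘L A ∘L T = A := by
    ext x
    refine ext_inner_right ℂ fun y => ?_
    have h1 : Delta S (Z x) = ContinuousLinearMap.adjoint S (Delta S (S (Z x))) :=
      congrArg (fun X : K →L[ℂ] K => X (Z x)) htwo.symm
    change ⟪ContinuousLinearMap.adjoint T (A (T x)), y⟫_ℂ = _
    rw [ContinuousLinearMap.adjoint_inner_left, hA, hA, h1,
      ContinuousLinearMap.adjoint_inner_left, hker, hSsa, hSsa, hker]
  have hle : Delta T ≤ A := by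
    refine (le_iff_re_inner_le (isSelfAdjoint_Delta T) hAsa).2 fun x => ?_
    rw [hA, re_inner_Delta, re_inner_Delta, Z.norm_map]
    have h1 : ‖T x‖ ≤ ‖S (Z x)‖ := by
      rw [← hZZ x, ← hZS, hZZ]
      refine ((ContinuousLinearMap.adjoint ζ).le_of_opNorm_le ?_ _).trans (one_mul _).le
      rw [LinearIsometryEquiv.norm_map]
      exact Z.norm_toContinuousLinearMap_le
    gcongr
  exact ⟨A, ⟨hΔ.trans hle, hTA.le⟩, hle, hΔ⟩

end Implications

/-! ### The minimal type I lifting -/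

section Lifting

variable {H : Type u} [NormedAddCommGroup H] [InnerProductSpace ℂ H] [CompleteSpace H]

/-- An invariant majorant `B` of `Δ_T` yields a minimal type I lifting: with `D* D = B - Δ_T`, the
operator `S (h, s) = (T h, (D h, s 0, s 1, …))` on `H ⊕ ℓ²(ℕ, closure (ran D))` has
`Δ_S = B ⊕ 0`. -/
theorem hasMinimalTypeILifting_of_invariant {T B : H →L[ℂ] H} (hT : 0 ≤ Delta T)
    (hTB : Delta T ≤ B) (hB : ContinuousLinearMap.adjoint T ∘L B ∘L T = B) :
    HasMinimalTypeILifting T := by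
  obtain ⟨D, hD⟩ := exists_adjoint_comp_self_eq (sub_nonneg.2 hTB)
  obtain ⟨R, rfl⟩ := exists_adjoint_comp_self_eq (hT.trans hTB)
  have hRT := norm_apply_eq_of_invariant hB
  have hTD : ∀ x, ‖T x‖ ^ 2 + ‖D x‖ ^ 2 = ‖x‖ ^ 2 + ‖R x‖ ^ 2 := fun x => by
    have h1 := re_inner_adjoint_comp_self D x
    rw [← hD, sub_apply, inner_sub_left, Complex.sub_re, re_inner_adjoint_comp_self,
      re_inner_Delta] at h1
    linarith
  let M : Submodule ℂ H := (LinearMap.range D.toLinearMap).topologicalClosure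
  have : CompleteSpace M :=
    (LinearMap.range D.toLinearMap).isClosed_topologicalClosure.completeSpace_coe
  let D' : H →L[ℂ] M := D.codRestrict M fun x => subset_closure ⟨x, rfl⟩
  let K := WithLp 2 (H × SeqSpace M)
  let π : K →L[ℂ] H := WithLp.fstL 2 ℂ H (SeqSpace M)
  let Z : H →ₗᵢ[ℂ] K := inlLI H (SeqSpace M)
  let S : K →L[ℂ] K :=
    pairL (T ∘L π) (consL M ∘L pairL (D' ∘L π) (WithLp.sndL 2 ℂ H (SeqSpace M)))
  have hS : ∀ z, S z = WithLp.toLp 2 (T z.fst, consSeq (D' z.fst) z.snd) := fun z => rfl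
  have hZ : ∀ x k, ⟪Z x, k⟫_ℂ = ⟪x, k.fst⟫_ℂ := fun x k => by
    rw [WithLp.prod_inner_apply]
    change ⟪x, k.fst⟫_ℂ + ⟪(0 : SeqSpace M), k.snd⟫_ℂ = _
    rw [inner_zero_left, add_zero]
  have hnorm : ∀ z, ‖S z‖ ^ 2 = ‖z‖ ^ 2 + ‖R z.fst‖ ^ 2 := fun z => by
    have h1 := hTD z.fst
    have h2 : ‖D' z.fst‖ = ‖D z.fst‖ := rfl
    rw [hS, norm_sq_toLp, norm_sq_consSeq, WithLp.prod_norm_sq_eq_of_L2 z, h2]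
    linarith
  have hΔ : Delta S = ContinuousLinearMap.adjoint (R ∘L π) ∘L (R ∘L π) := by
    refine eq_of_re_inner_eq (isSelfAdjoint_Delta S) (isSelfAdjoint_adjoint_comp_self _)
      fun z => ?_
    rw [re_inner_Delta, re_inner_adjoint_comp_self, hnorm, add_sub_cancel_left]
    rfl
  refine ⟨K, inferInstance, inferInstance, inferInstance, Z, S, ?_, ?_, ?_, ?_⟩
  · ext1 x
    refine ext_inner_right ℂ fun k => ?_
    change ⟪Z (ContinuousLinearMap.adjoint T x), k⟫_ℂ =
      ⟪ContinuousLinearMap.adjoint S (Z x), k⟫_ℂ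
    rw [ContinuousLinearMap.adjoint_inner_left, hZ, hZ, ContinuousLinearMap.adjoint_inner_left]
    rfl
  · have h1 : ContinuousLinearMap.adjoint S ∘L Delta S ∘L S =
        ContinuousLinearMap.adjoint ((R ∘L π) ∘L S) ∘L ((R ∘L π) ∘L S) := by
      rw [hΔ, ContinuousLinearMap.adjoint_comp (R ∘L π) S]; rfl
    rw [IsTwoIsometry, h1, hΔ]
    refine eq_of_re_inner_eq (isSelfAdjoint_adjoint_comp_self _)
      (isSelfAdjoint_adjoint_comp_self _) fun z => ?_
    rw [re_inner_adjoint_comp_self, re_inner_adjoint_comp_self]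
    exact congrArg (· ^ 2) (hRT z.fst)
  · intro k hk
    have h1 : k.fst = 0 := by
      refine ext_inner_left ℂ fun x => ?_
      rw [← hZ, inner_zero_right]
      exact hk _ ⟨x, rfl⟩
    change Delta S k = 0
    have h2 : π k = 0 := h1
    simp [hΔ, h2]
  · let P : Submodule ℂ K := ⨆ n : ℕ, (LinearMap.range Z.toLinearMap).map (S ^ n).toLinearMap
    have hmem : ∀ n x, (S ^ n) (Z x) ∈ P := fun n x =>
      Submodule.mem_iSup_of_mem n ⟨Z x, ⟨x, rfl⟩, rfl⟩
    have hPS : ∀ z ∈ P, S z ∈ P := by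
      have h : P ≤ P.comap S.toLinearMap := by
        refine iSup_le fun n => ?_
        rintro _ ⟨_, ⟨x, rfl⟩, rfl⟩
        have h1 := hmem (n + 1) x
        rw [pow_succ'] at h1
        exact h1
      exact h
    -- `S h - T h` is `D h` placed in the first coordinate, and `S` shifts the coordinates.
    have hsingle : ∀ n x, (WithLp.toLp 2 (0, lp.single 2 n (D' x)) : K) ∈ P := by
      intro n x
      induction n with
      | zero =>
        have h1 : (WithLp.toLp 2 (0, lp.single 2 0 (D' x)) : K) = S (Z x) - Z (T x) := by
          refine (WithLp.equiv 2 _).injective (Prod.ext (sub_self (T x)).symm ?_)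
          refine lp.ext (funext fun n => ?_)
          change (lp.single 2 0 (D' x) : SeqSpace M) n = consSeq (D' x) 0 n - (0 : M)
          cases n <;> simp [lp.single_apply]
        rw [h1]
        exact P.sub_mem (hmem 1 x) (hmem 0 (T x))
      | succ n ih =>
        have h1 : (WithLp.toLp 2 (0, lp.single 2 (n + 1) (D' x)) : K) =
            S (WithLp.toLp 2 (0, lp.single 2 n (D' x))) := by
          refine (WithLp.equiv 2 _).injective (Prod.ext (map_zero T).symm ?_)
          refine lp.ext (funext fun m => ?_)
          change (lp.single 2 (n + 1) (D' x) : SeqSpace M) m =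
            consSeq (D' 0) (lp.single 2 n (D' x)) m
          cases m <;> simp [lp.single_apply, Pi.single_apply]
        rw [h1]
        exact hPS _ ih
    change P.topologicalClosure = ⊤
    rw [Submodule.topologicalClosure_eq_top_iff, Submodule.eq_bot_iff]
    intro k hk
    have hfst : k.fst = 0 := by
      refine ext_inner_left ℂ fun x => ?_
      rw [← hZ, inner_zero_right]
      exact hk _ (hmem 0 x)
    have hsnd : ∀ n, k.snd n = 0 := fun n => by
      have h1 : ((k.snd n : M) : H) ∈ (LinearMap.range D.toLinearMap)ᗮ := by
        rintro _ ⟨x, rfl⟩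
        have h2 := hk _ (hsingle n x)
        rw [WithLp.prod_inner_apply] at h2
        change ⟪(0 : H), k.fst⟫_ℂ + ⟪lp.single 2 n (D' x), k.snd⟫_ℂ = 0 at h2
        rw [inner_zero_left, zero_add, lp.inner_single_left] at h2
        exact h2
      rw [← Submodule.orthogonal_closure] at h1
      have h3 := h1 _ (k.snd n).2
      exact Subtype.ext (inner_self_eq_zero.1 h3)
    exact (WithLp.equiv 2 _).injective (Prod.ext hfst (lp.ext (funext hsnd)))

end Lifting

end TwoIsometricLifting

open TwoIsometricLifting in
theorem theorem3p5 {H : Type u} [NormedAddCommGroup H] [InnerProductSpace ℂ H] [CompleteSpace H]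
    (T : H →L[ℂ] H) :
    List.TFAE [
      TwoIsometricLifting.IsExpansive T ∧ TwoIsometricLifting.HasMinimalTypeILifting T,
      ∃ A : H →L[ℂ] H, TwoIsometricLifting.IsAContraction T A ∧
        TwoIsometricLifting.Delta T ≤ A ∧ 0 ≤ TwoIsometricLifting.Delta T,
      ∃ δ : ℝ, TwoIsometricLifting.HasBlockExtension T δ] ∧
    ∀ A : H →L[ℂ] H, TwoIsometricLifting.IsAContraction T A →
      TwoIsometricLifting.Delta T ≤ A → 0 ≤ TwoIsometricLifting.Delta T →
      TwoIsometricLifting.HasBlockExtension T (Real.sqrt ‖A‖) := by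
  have hblock : ∀ A : H →L[ℂ] H, IsAContraction T A → Delta T ≤ A → 0 ≤ Delta T →
      HasBlockExtension T (Real.sqrt ‖A‖) := by
    intro A hA hTA hT
    obtain ⟨B, hAB, hB, hBn⟩ := exists_invariant_majorant hA.1 hA.2 hT
    refine hasBlockExtension_of_invariant (Real.sqrt_nonneg _) hT (hTA.trans hAB) hB ?_ ?_
    · rwa [Real.sq_sqrt (norm_nonneg _)]
    · exact Real.sqrt_le_sqrt (CStarAlgebra.norm_le_norm_of_nonneg_of_le hT hTA)
  refine ⟨?_, hblock⟩
  tfae_have 1 → 2 := fun h => exists_of_hasMinimalTypeILifting h.1 h.2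
  tfae_have 2 → 1 := by
    rintro ⟨A, hA, hTA, hT⟩
    obtain ⟨B, hAB, hB, -⟩ := exists_invariant_majorant hA.1 hA.2 hT
    exact ⟨isExpansive_iff.2 hT, hasMinimalTypeILifting_of_invariant hT (hTA.trans hAB) hB⟩
  tfae_have 2 → 3 := fun ⟨A, hA, hTA, hT⟩ => ⟨_, hblock A hA hTA hT⟩
  tfae_have 3 → 2 := fun ⟨δ, h⟩ => exists_invariant_of_hasBlockExtension h
  tfae_finish
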